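/- Let $\mu_{\mathrm{geo}}$ be the geometric distribution on $\mathbb N=\{0,1,2,\dots\}$ with $\mu_{\mathrm{geo}}(x)=1/2^{x+1}$. A zip tree is a binary search tree (with keys in a linearly ordered set) whose nodes carry ranks in $\mathbb N$ such that the rank of a left child is strictly smaller, and the rank of a right child is at most, the rank of its parent. Insertion of a new node $v$ (key $k$, rank $r$) into a zip tree is recursive. Into the empty tree, it returns the one-node tree $v$; if the root has key $k$, the tree is unchanged. If $k$ is less than the key of the root $w$, let $t$ be the result of inserting $v$ into the left subtree of $w$; if $\mathrm{rank}(t)<\mathrm{rank}(w)$, then $t$ becomes the left subtree of $w$; otherwise the right subtree of $t$ becomes the left subtree of $w$, and $w$ becomes the right child of the root of $t$. The case where $k$ is greater than the key of $w$ is symmetric, with the test $\mathrm{rank}(t)\le\mathrm{rank}(w)$. Deletion of $k$ searches recursively for $k$; if it reaches the empty tree, nothing changes; if it finds a node with key $k$, it replaces the subtree rooted there by the zip of its left and right subtrees. Zipping $s$ with $t$ returns the other tree if one of them is empty; if $\mathrm{rank}(s)<\mathrm{rank}(t)$, it replaces the left subtree $t_{\mathrm{left}}$ of $t$ by the zip of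 $s$ with $t_{\mathrm{left}}$; otherwise it replaces the right subtree $s_{\mathrm{right}}$ of $s$ by the zip of $s_{\mathrm{right}}$ with $t$. The cost of an insertion is the number of recursive calls of the insertion procedure; the cost of a deletion is the number of recursive calls of the deletion procedure plus the number of recursive calls of the zip procedure (the initial call of each procedure is not counted). The ancestors of a node $x$ are the nodes other than $x$ on the search path from the root to $x$; those with a key greater (respectively, smaller) than that of $x$ are its high (respectively, low) ancestors. The depth of $x$ is the number of its ancestors. Let $n\ge 1$, and let $T$ be the random zip tree obtained from the empty tree by inserting $n$ distinct keys, in any fixed order, each with a rank drawn independently from $\mu_{\mathrm{geo}}$. Then: 1. For each of the $n$ keys, the node $x$ with this key satisfies $$\mathbb E[\mathrm{depth}(x)]\le \tfrac32(\log_2 n+1),\quad \mathbb E[\#\{\text{high ancestors of }x\}]\le \tfrac12(\log_2 n+1),\quad \mathbb E[\#\{\text{low ancestors of }x\}]\le \log_2 n+1 .$$ 2. For every key $k$, the expected cost of inserting $k$ into $T$ with an independent rank drawn from $\mu_{\mathrm{geo}}$ is at most $\tfrac32\log_2 n+\tfrac32$. 3. For every key $k$, the expected cost of deleting $k$ from $T$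 is at most $\tfrac32\log_2 n+\tfrac32$. -/

import Mathlib

open scoped ENNReal

/-- Ranked binary trees: a nonempty tree has a rank (a natural number), a key, a left child and a
right child. -/
inductive RankedTree (α : Type*) where
  | empty : RankedTree α
  | node (rank : ℕ) (key : α) (left right : RankedTree α) : RankedTree α

namespace RankedTree

variable {α : Type*}

/-- The rank of the root, with the value `-1` for the empty tree. -/
def rk : RankedTree α → ℤ
  | empty => -1
  | node r _ _ _ => r

/-- The left child (the empty tree has no children; the value there is never used). -/
def left : RankedTree α → RankedTree α
  | empty => empty
  | node _ _ l _ => l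

/-- The right child (the empty tree has no children; the value there is never used). -/
def right : RankedTree α → RankedTree α
  | empty => empty
  | node _ _ _ r => r

/-- Replace the left child of a nonempty tree. -/
def setLeft : RankedTree α → RankedTree α → RankedTree α
  | empty, _ => empty
  | node r k _ b, a => node r k a b

/-- Replace the right child of a nonempty tree. -/
def setRight : RankedTree α → RankedTree α → RankedTree α
  | empty, _ => empty
  | node r k a _, b => node r k a b

/-- The number of nodes. -/
def size : RankedTree α → ℕ
  | empty => 0
  | node _ _ l r => l.size + r.size + 1

/-- The set of keys. -/
def keys : RankedTree α → Set α
  | empty => ∅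
  | node _ k l r => {k} ∪ (l.keys ∪ r.keys)

/-- Zip trees: binary search trees whose ranks strictly decrease towards left children and do not
increase towards right children. -/
def IsZipTree [LinearOrder α] : RankedTree α → Prop
  | empty => True
  | node r k a b =>
      (∀ y ∈ a.keys, y < k) ∧ (∀ y ∈ b.keys, k < y) ∧ a.rk < r ∧ b.rk ≤ r ∧
        a.IsZipTree ∧ b.IsZipTree

/-- Insertion of the key `k` with rank `r`. The result is the new tree together with the cost, the
number of recursive calls. -/
def insert [LinearOrder α] (r : ℕ) (k : α) : RankedTree α → RankedTree α × ℕ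
  | empty => (node r k empty empty, 0)
  | node rank key a b =>
    if k = key then (node rank key a b, 0)
    else if k < key then
      let t := insert r k a
      if t.1.rk < rank then (node rank key t.1 b, t.2 + 1)
      else (t.1.setRight (node rank key t.1.right b), t.2 + 1)
    else
      let t := insert r k b
      if t.1.rk ≤ rank then (node rank key a t.1, t.2 + 1)
      else (t.1.setLeft (node rank key a t.1.left), t.2 + 1)

/-- Zipping two trees (used when all keys of the first are smaller than all keys of the second).
The result is the zipped tree together with the cost, the number of recursive calls. -/
def zip : RankedTree α → RankedTree α → RankedTree α × ℕ
  | empty, t => (t, 0)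
  | node r k a b, empty => (node r k a b, 0)
  | node r₁ k₁ a₁ b₁, node r₂ k₂ a₂ b₂ =>
    if r₁ < r₂ then
      let t := zip (node r₁ k₁ a₁ b₁) a₂
      (node r₂ k₂ t.1 b₂, t.2 + 1)
    else
      let t := zip b₁ (node r₂ k₂ a₂ b₂)
      (node r₁ k₁ a₁ t.1, t.2 + 1)
  termination_by s t => s.size + t.size
  decreasing_by all_goals simp only [size]; omega

/-- Deletion of the key `k`. The result is the new tree together with the cost, the number of
recursive calls of the deletion itself and of the zipping it ends with. -/
def delete [LinearOrder α] (k : α) : RankedTree α → RankedTree α × ℕ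
  | empty => (empty, 0)
  | node rank key a b =>
    if k < key then
      let t := delete k a
      (node rank key t.1 b, t.2 + 1)
    else if key < k then
      let t := delete k b
      (node rank key a t.1, t.2 + 1)
    else zip a b

/-- The proper ancestors of the node with key `x`: the keys met before `x` on the search path for
`x` that starts at the root. -/
def ancestors [LinearOrder α] (x : α) : RankedTree α → List α
  | empty => []
  | node _ key a b =>
    if x = key then []
    else if x < key then key :: ancestors x a
    else key :: ancestors x b

/-- The depth of the node with key `x`: the number of its ancestors (the root has depth `0`). -/
def depth [LinearOrder α] (x : α) (t : RankedTree α) : ℕ := (t.ancestors x).length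

/-- The number of high ancestors of `x`: the ancestors with a greater key. -/
def numHigh [LinearOrder α] (x : α) (t : RankedTree α) : ℕ :=
  ((t.ancestors x).filter (fun y => x < y)).length

/-- The number of low ancestors of `x`: the ancestors with a smaller key. -/
def numLow [LinearOrder α] (x : α) (t : RankedTree α) : ℕ :=
  ((t.ancestors x).filter (fun y => y < x)).length

end RankedTree

/-- The geometric distribution with success probability `1/2`: `geo x = 1 / 2 ^ (x + 1)`. -/
noncomputable def geo : PMF ℕ :=
  ⟨fun x => 1 / 2 ^ (x + 1), by
    have h : ∑' x : ℕ, (1 / 2 ^ (x + 1) : ℝ≥0∞) = 1 := by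
      simp only [one_div, ENNReal.inv_pow, ENNReal.tsum_geometric_add_one,
        ENNReal.one_sub_inv_two, inv_inv]
      exact ENNReal.inv_mul_cancel (by simp) (by simp)
    have h2 := (ENNReal.summable (f := fun x : ℕ => (1 / 2 ^ (x + 1) : ℝ≥0∞))).hasSum
    rwa [h] at h2⟩

/-- The random tree built by inserting the keys of a list, the last key first, with ranks drawn
independently from the geometric distribution. -/
noncomputable def insertList {α : Type*} [LinearOrder α] : List α → PMF (RankedTree α)
  | [] => PMF.pure RankedTree.empty
  | x :: xs => geo.bind fun r => (insertList xs).map fun t => (t.insert r x).1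

/-- Insertion of the key `k` with a random rank drawn from the geometric distribution: the
distribution of the new tree together with the cost. -/
noncomputable def randomInsert {α : Type*} [LinearOrder α] (k : α) (t : RankedTree α) :
    PMF (RankedTree α × ℕ) :=
  geo.map fun r => t.insert r k

/-- The expected value in `[0, ∞]` of a function with values in `ℕ`. -/
noncomputable def expect {β : Type*} (p : PMF β) (f : β → ℕ) : ℝ≥0∞ :=
  ∑' b, p b * (f b : ℝ≥0∞)

namespace RankedTree

theorem rk_node {α : Type*} (r : ℕ) (k : α) (a b : RankedTree α) : (node r k a b).rk = r := rfl

/-- Insertion yields a zip tree with the expected keys; either the rank of the root does not grow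
or the new node is the root, above subtrees of bounded rank. -/
theorem insert_spec {α : Type*} [LinearOrder α] (r : ℕ) (k : α) (t : RankedTree α)
    (ht : t.IsZipTree) :
    (t.insert r k).1.IsZipTree ∧ (t.insert r k).1.keys = {k} ∪ t.keys ∧
      ((t.insert r k).1.rk ≤ t.rk ∨
        ∃ a b, (t.insert r k).1 = node r k a b ∧ a.rk ≤ t.rk ∧ b.rk ≤ t.rk) := by
  induction t with
  | empty =>
    simp only [insert, IsZipTree, keys, rk]
    refine ⟨by simp; omega, by simp, Or.inr ⟨empty, empty, rfl, le_rfl, le_rfl⟩⟩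
  | node rank key a b iha ihb =>
    obtain ⟨hl, hr, hla, hlb, hza, hzb⟩ := ht
    obtain ⟨iha1, iha2, iha3⟩ := iha hza
    obtain ⟨ihb1, ihb2, ihb3⟩ := ihb hzb
    rw [insert]
    split_ifs with h1 h2
    · subst h1
      exact ⟨⟨hl, hr, hla, hlb, hza, hzb⟩, by simp [keys], Or.inl le_rfl⟩
    · dsimp only
      split_ifs with h3
      · refine ⟨⟨?_, hr, h3, hlb, iha1, hzb⟩, ?_, Or.inl le_rfl⟩
        · rw [iha2]; rintro y (rfl | hy)
          · exact h2
          · exact hl y hy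
        · simp only [keys, iha2]; ext y; simp only [Set.mem_union, Set.mem_singleton_iff]; clear * -; tauto
      · rcases iha3 with h | ⟨a', b', he, ha', hb'⟩
        · omega
        · rw [he] at iha1 iha2 h3 ⊢
          simp only [keys, Set.ext_iff, Set.mem_union, Set.mem_singleton_iff] at iha2
          simp only [IsZipTree, rk_node] at iha1 h3
          obtain ⟨g1, g2, g3, g4, g5, g6⟩ := iha1
          simp only [setRight, right, IsZipTree, keys, rk_node, Set.mem_union, Set.mem_singleton_iff]
          refine ⟨⟨g1, ?_, g3, by omega, g5, ?_, hr, by omega, hlb, g6, hzb⟩, ?_,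
            Or.inr ⟨_, _, rfl, by omega, le_rfl⟩⟩
          · rintro y (rfl | hy | hy)
            · exact h2
            · exact g2 y hy
            · exact h2.trans (hr y hy)
          · intro y hy
            rcases (iha2 y).1 (Or.inr (Or.inr hy)) with rfl | hy'
            · exact h2
            · exact hl y hy'
          · ext y; have := iha2 y; clear * - this; simp only [Set.mem_union, Set.mem_singleton_iff]; tauto
    · have h2' : key < k := lt_of_le_of_ne (not_lt.1 h2) (Ne.symm h1)
      dsimp only
      split_ifs with h3
      · refine ⟨⟨hl, ?_, hla, h3, hza, ihb1⟩, ?_, Or.inl le_rfl⟩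
        · rw [ihb2]; rintro y (rfl | hy)
          · exact h2'
          · exact hr y hy
        · simp only [keys, ihb2]; ext y; simp only [Set.mem_union, Set.mem_singleton_iff]; clear * -; tauto
      · rcases ihb3 with h | ⟨a', b', he, ha', hb'⟩
        · omega
        · rw [he] at ihb1 ihb2 h3 ⊢
          simp only [keys, Set.ext_iff, Set.mem_union, Set.mem_singleton_iff] at ihb2
          simp only [IsZipTree, rk_node] at ihb1 h3
          obtain ⟨g1, g2, g3, g4, g5, g6⟩ := ihb1
          simp only [setLeft, left, IsZipTree, keys, rk_node, Set.mem_union, Set.mem_singleton_iff]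
          refine ⟨⟨?_, g2, by omega, g4, ⟨hl, ?_, hla, by omega, hza, g5⟩, g6⟩, ?_,
            Or.inr ⟨_, _, rfl, le_rfl, by omega⟩⟩
          · rintro y (rfl | hy | hy)
            · exact h2'
            · exact (hl y hy).trans h2'
            · exact g1 y hy
          · intro y hy
            rcases (ihb2 y).1 (Or.inr (Or.inl hy)) with rfl | hy'
            · exact h2'
            · exact hr y hy'
          · ext y; have := ihb2 y; clear * - this; simp only [Set.mem_union, Set.mem_singleton_iff]; tauto

/-- The trees built by insertion are zip trees, and their keys are the keys inserted. -/
theorem insertList_spec {α : Type*} [LinearOrder α] (l : List α) (t : RankedTree α)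
    (ht : t ∈ (insertList l).support) : t.IsZipTree ∧ t.keys = {x | x ∈ l} := by
  induction l generalizing t with
  | nil =>
    simp only [insertList, PMF.support_pure, Set.mem_singleton_iff] at ht
    subst ht
    simp [IsZipTree, keys]
  | cons x xs ih =>
    simp only [insertList, PMF.mem_support_bind_iff, PMF.mem_support_map_iff] at ht
    obtain ⟨r, -, s, hs, rfl⟩ := ht
    obtain ⟨h1, h2⟩ := ih s hs
    obtain ⟨h3, h4, -⟩ := insert_spec r x s h1
    refine ⟨h3, ?_⟩
    rw [h4, h2]
    ext y
    simp

end RankedTree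

/-! Insertion only moves nodes about, so in the final tree the ranks of the keys are the ranks
drawn, independent whatever the insertion order (`expectENN_weight`). The shape enters only through
records: a high ancestor `y` of `x` has a rank strictly greater than all ranks of keys in `[x, y)`,
and a low ancestor has a rank at least as large as all ranks of keys in `(y, x]`. By linearity, the
expected number of ancestors is at most a sum of record probabilities `strictRecord j` or
`weakRecord j`, where `j` counts the competitors and takes consecutive values as `y` varies
(`expect_length_le`, `Finset.sum_card_filter_lt`).

Put `p = 1 - 1 / 2 ^ (q + 1)`, the probability of a rank at most `q`. Since `geo q = 1 - p`, rank
`q` contributes `geo q * ∑ j < m, p ^ j = 1 - p ^ m` to the sum of the weak record probabilities.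
This is at most `1` and at most `m * geo q`; the first bound for `q < L = ⌊log₂ m⌋` and the second
for `q ≥ L` give `L + m / 2 ^ L ≤ log₂ m + 1` (`sum_weakRecord_le`). A strict record against at
least one competitor is half as likely as a weak one (`strictRecord_succ`), which explains the
factor `1/2` for high ancestors.

The costs of insertion and deletion are bounded by the number of keys on the search path for `k`,
continued into both subtrees of a node with key `k`. These keys are records over the open intervals
between them and `k`. With `a` keys above `k` and `b` below, the bounds `1 + (log₂ a) / 2` and `1 +
log₂ b` are combined through `4ab ≤ n²`. -/

/-- The expected value in `[0, ∞]` of a function with values in `[0, ∞]`. -/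
noncomputable def expectENN {β : Type*} (p : PMF β) (F : β → ℝ≥0∞) : ℝ≥0∞ :=
  ∑' b, p b * F b

/-! ### Expectations with values in `[0, ∞]` -/

section Expect

variable {β γ : Type*}

theorem expect_eq_expectENN (p : PMF β) (f : β → ℕ) :
    expect p f = expectENN p fun b => (f b : ℝ≥0∞) := rfl

theorem expectENN_bind (p : PMF β) (g : β → PMF γ) (F : γ → ℝ≥0∞) :
    expectENN (p.bind g) F = expectENN p fun b => expectENN (g b) F := by
  simp only [expectENN, PMF.bind_apply, ← ENNReal.tsum_mul_right, ← ENNReal.tsum_mul_left]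
  rw [ENNReal.tsum_comm]
  simp only [mul_assoc]

theorem expectENN_pure (b : β) (F : β → ℝ≥0∞) : expectENN (PMF.pure b) F = F b := by
  rw [expectENN, tsum_eq_single b]
  · simp
  · intro c hc
    simp [PMF.pure_apply, hc]

theorem expectENN_map (p : PMF β) (g : β → γ) (F : γ → ℝ≥0∞) :
    expectENN (p.map g) F = expectENN p fun b => F (g b) := by
  rw [← PMF.bind_pure_comp, expectENN_bind]
  simp only [Function.comp_apply, expectENN_pure]

theorem expectENN_mono {p : PMF β} {F G : β → ℝ≥0∞} (h : ∀ b ∈ p.support, F b ≤ G b) :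
    expectENN p F ≤ expectENN p G := by
  refine ENNReal.tsum_le_tsum fun b => ?_
  by_cases hb : p b = 0
  · simp [hb]
  · exact mul_le_mul_right (h b ((PMF.mem_support_iff _ _).2 hb)) _

theorem expectENN_congr {p : PMF β} {F G : β → ℝ≥0∞} (h : ∀ b ∈ p.support, F b = G b) :
    expectENN p F = expectENN p G :=
  le_antisymm (expectENN_mono fun b hb => (h b hb).le) (expectENN_mono fun b hb => (h b hb).ge)

theorem expectENN_const (p : PMF β) (c : ℝ≥0∞) : expectENN p (fun _ => c) = c := by
  rw [expectENN, ENNReal.tsum_mul_right, p.tsum_coe, one_mul]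

theorem expectENN_const_mul (p : PMF β) (c : ℝ≥0∞) (F : β → ℝ≥0∞) :
    expectENN p (fun b => c * F b) = c * expectENN p F := by
  simp only [expectENN, ← ENNReal.tsum_mul_left]
  exact tsum_congr fun b => by ring

theorem expectENN_add (p : PMF β) (F G : β → ℝ≥0∞) :
    expectENN p (fun b => F b + G b) = expectENN p F + expectENN p G := by
  simp only [expectENN, mul_add, ENNReal.tsum_add]

theorem expectENN_finset_sum {ι : Type*} (p : PMF β) (s : Finset ι) (F : ι → β → ℝ≥0∞) :
    expectENN p (fun b => ∑ i ∈ s, F i b) = ∑ i ∈ s, expectENN p (F i) := by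
  simp only [expectENN, Finset.mul_sum]
  exact Summable.tsum_finsetSum fun _ _ => ENNReal.summable

theorem expectENN_tsum {ι : Type*} (p : PMF β) (F : ι → β → ℝ≥0∞) :
    expectENN p (fun b => ∑' i, F i b) = ∑' i, expectENN p (F i) := by
  simp only [expectENN, ← ENNReal.tsum_mul_left]
  exact ENNReal.tsum_comm

end Expect

/-! ### Independence of the ranks and the record bound -/

namespace RankedTree

variable {α : Type*}

/-- The set of pairs of a key and its rank. -/
def nodes : RankedTree α → Set (α × ℕ)
  | empty => ∅
  | node r k a b => {(k, r)} ∪ (a.nodes ∪ b.nodes)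

/-- The product over all nodes of a function of key and rank. -/
noncomputable def weight (f : α → ℕ → ℝ≥0∞) : RankedTree α → ℝ≥0∞
  | empty => 1
  | node r k a b => f k r * (a.weight f * b.weight f)

theorem weight_eq_one {f : α → ℕ → ℝ≥0∞} {t : RankedTree α}
    (h : ∀ z r, (z, r) ∈ t.nodes → f z r = 1) : t.weight f = 1 := by
  induction t with
  | empty => rfl
  | node r k a b iha ihb =>
    simp only [nodes, Set.mem_union, Set.mem_singleton_iff, Prod.mk.injEq] at h
    rw [weight, h k r (.inl ⟨rfl, rfl⟩), iha fun z q hz => h z q (.inr (.inl hz)),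
      ihb fun z q hz => h z q (.inr (.inr hz))]
    simp

theorem mem_keys_of_mem_nodes {t : RankedTree α} {z : α} {r : ℕ} (h : (z, r) ∈ t.nodes) :
    z ∈ t.keys := by
  induction t with
  | empty => exact h
  | node q k a b iha ihb =>
    simp only [nodes, keys, Set.mem_union, Set.mem_singleton_iff, Prod.mk.injEq] at h ⊢
    tauto

variable [LinearOrder α]

theorem IsZipTree.le_rk_of_mem_nodes {t : RankedTree α} (ht : t.IsZipTree) {z : α} {r : ℕ}
    (h : (z, r) ∈ t.nodes) : (r : ℤ) ≤ t.rk := by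
  induction t with
  | empty => exact h.elim
  | node q k a b iha ihb =>
    obtain ⟨-, -, ha, hb, hza, hzb⟩ := ht
    simp only [nodes, Set.mem_union, Set.mem_singleton_iff, Prod.mk.injEq] at h
    rw [rk_node]
    rcases h with ⟨-, rfl⟩ | h | h
    · rfl
    · exact (iha hza h).trans ha.le
    · exact (ihb hzb h).trans hb

/-- Rules out the default values of `setLeft` and `setRight` at `empty`, which would lose nodes in a
rotation. -/
theorem insert_ne_empty (r : ℕ) (k : α) (t : RankedTree α) : (t.insert r k).1 ≠ empty := by
  cases t with
  | empty => simp [insert]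
  | node q key a b =>
    rw [insert]
    have ha := insert_ne_empty r k a
    have hb := insert_ne_empty r k b
    split_ifs
    · simp
    all_goals dsimp only; split_ifs
    · simp
    · cases h : (a.insert r k).1 <;> simp_all [setRight]
    · simp
    · cases h : (b.insert r k).1 <;> simp_all [setLeft]

/-- Rotations preserve the pairs of key and rank, and a commutative product does not see their
position. If `k` were present, the new rank would be discarded. -/
theorem weight_insert (f : α → ℕ → ℝ≥0∞) (r : ℕ) (k : α) (t : RankedTree α) (hk : k ∉ t.keys) :
    (t.insert r k).1.weight f = f k r * t.weight f := by
  induction t with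
  | empty => simp [insert, weight]
  | node q key a b iha ihb =>
    simp only [keys, Set.mem_union, Set.mem_singleton_iff, not_or] at hk
    obtain ⟨hk, hka, hkb⟩ := hk
    specialize iha hka
    specialize ihb hkb
    rw [insert, if_neg hk]
    split_ifs with h
    all_goals dsimp only; split_ifs
    · simp only [weight, iha]; ring
    · cases h : (a.insert r k).1 with
      | empty => exact absurd h (insert_ne_empty r k a)
      | node r' k' a' b' =>
        simp only [h, weight, setRight, right] at iha ⊢
        rw [show f k r * (f key q * (a.weight f * b.weight f)) =
          f key q * (f k r * a.weight f) * b.weight f by ring, ← iha]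
        ring
    · simp only [weight, ihb]; ring
    · cases h : (b.insert r k).1 with
      | empty => exact absurd h (insert_ne_empty r k b)
      | node r' k' a' b' =>
        simp only [h, weight, setLeft, left] at ihb ⊢
        rw [show f k r * (f key q * (a.weight f * b.weight f)) =
          f key q * (f k r * b.weight f) * a.weight f by ring, ← ihb]
        ring

/-- The ranks of the nodes are independent. -/
theorem expectENN_weight (f : α → ℕ → ℝ≥0∞) (l : List α) (hl : l.Nodup) :
    expectENN (insertList l) (weight f) = ∏ x ∈ l.toFinset, expectENN geo (f x) := by
  induction l with
  | nil => simp [insertList, expectENN_pure, weight]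
  | cons x xs ih =>
    obtain ⟨hx, hxs⟩ := List.nodup_cons.1 hl
    rw [List.toFinset_cons, Finset.prod_insert (by simpa using hx), ← ih hxs, insertList,
      expectENN_bind]
    simp only [expectENN_map]
    rw [mul_comm, ← expectENN_const_mul]
    refine expectENN_congr fun r _ => ?_
    rw [mul_comm, ← expectENN_const_mul]
    refine expectENN_congr fun t ht => weight_insert f r x t ?_
    rw [(insertList_spec xs t ht).2]
    exact hx

/-- If the elements of a random list are records of the ranks, each over the set `S y`, then the
expected length of the list is at most the sum of the probabilities of being a record. -/
theorem expect_length_le (l : List α) (hl : l.Nodup) (path : RankedTree α → List α)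
    (U : Finset α) (hU : U ⊆ l.toFinset) (S : α → Set α) (B : ℕ → Set ℕ) (hS : ∀ y, y ∉ S y)
    (hnodup : ∀ t ∈ (insertList l).support, (path t).Nodup)
    (hmem : ∀ t ∈ (insertList l).support, ∀ y ∈ path t, y ∈ U)
    (hrec : ∀ t ∈ (insertList l).support, ∀ y ∈ path t,
      ∃ q, ∀ z r, (z, r) ∈ t.nodes → (z = y → r = q) ∧ (z ∈ S y → r ∈ B q)) :
    open scoped Classical in
    expect (insertList l) (fun t => (path t).length) ≤
      ∑ y ∈ U, ∑' q, geo q *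
        (expectENN geo ((B q).indicator 1)) ^ (l.toFinset.filter (· ∈ S y)).card := by
  classical
  let f : α → ℕ → α → ℕ → ℝ≥0∞ := fun y q z r =>
    if z = y then ({q} : Set ℕ).indicator 1 r else if z ∈ S y then (B q).indicator 1 r else 1
  have key : ∀ y ∈ U, ∀ q, expectENN (insertList l) (weight (f y q)) = geo q *
        (expectENN geo ((B q).indicator 1)) ^ (l.toFinset.filter (· ∈ S y)).card := by
    intro y hy q
    rw [expectENN_weight _ l hl, ← Finset.mul_prod_erase _ _ (hU hy)]
    congr 1
    · rw [expectENN, tsum_eq_single q]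
      · simp [f]
      · intro r hr
        simp [f, hr]
    · have h1 : l.toFinset.filter (· ∈ S y) = (l.toFinset.erase y).filter (· ∈ S y) := by
        ext z
        simp only [Finset.mem_filter, Finset.mem_erase]
        have := hS y
        constructor
        · rintro ⟨h, h'⟩
          exact ⟨⟨fun e => this (e ▸ h'), h⟩, h'⟩
        · tauto
      rw [h1, ← Finset.prod_const, Finset.prod_filter]
      refine Finset.prod_congr rfl fun z hz => ?_
      have hzy : z ≠ y := Finset.ne_of_mem_erase hz
      split_ifs with h
      · congr 1
        ext r
        simp [f, hzy, h]
      · convert expectENN_const geo 1 using 2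
        ext r
        simp [f, hzy, h]
  rw [← Finset.sum_congr rfl fun y hy => tsum_congr fun q => key y hy q]
  simp only [← expectENN_tsum, ← expectENN_finset_sum]
  rw [expect_eq_expectENN]
  refine expectENN_mono fun t ht => ?_
  rw [← List.toFinset_card_of_nodup (hnodup t ht), Finset.cast_card]
  refine (Finset.sum_le_sum fun y hy => ?_).trans
    (Finset.sum_le_sum_of_subset fun y hy => hmem t ht y (List.mem_toFinset.1 hy))
  -- For a key on the path, the event for its actual rank `q` occurs, so this single term of the sum
  -- over ranks is already `1`.
  obtain ⟨q, hq⟩ := hrec t ht y (List.mem_toFinset.1 hy)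
  refine le_trans (le_of_eq ?_) (ENNReal.le_tsum q)
  refine (weight_eq_one fun z r hz => ?_).symm
  obtain ⟨h1, h2⟩ := hq z r hz
  simp only [f]
  split_ifs with h3 h4
  · simp [h1 h3]
  · simp [h2 h4]
  · rfl

/-! ### Search paths and their records -/

/-- The keys greater than `k` on the search path for `k`, where the path continues in both subtrees
of the node with key `k`. -/
def hiPath (k : α) : RankedTree α → List α
  | empty => []
  | node _ key a b => if k < key then key :: hiPath k a else hiPath k b

/-- The keys smaller than `k` on the search path for `k`, where the path continues in both subtrees
of the node with key `k`. -/
def loPath (k : α) : RankedTree α → List α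
  | empty => []
  | node _ key a b => if key < k then key :: loPath k b else loPath k a

theorem mem_keys_of_mem_ancestors {k y : α} {t : RankedTree α} (h : y ∈ t.ancestors k) :
    y ∈ t.keys := by
  induction t with
  | empty => simp [ancestors] at h
  | node q key a b iha ihb =>
    simp only [ancestors] at h
    simp only [keys, Set.mem_union, Set.mem_singleton_iff]
    split_ifs at h
    · simp at h
    all_goals simp only [List.mem_cons] at h; tauto

theorem mem_of_mem_hiPath {k y : α} {t : RankedTree α} (ht : t.IsZipTree) (h : y ∈ t.hiPath k) :
    y ∈ t.keys ∧ k < y := by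
  induction t with
  | empty => simp [hiPath] at h
  | node q key a b iha ihb =>
    obtain ⟨-, -, -, -, hza, hzb⟩ := ht
    simp only [hiPath] at h
    simp only [keys, Set.mem_union, Set.mem_singleton_iff]
    split_ifs at h with h1
    · rcases List.mem_cons.1 h with rfl | h
      · tauto
      · have := iha hza h
        tauto
    · have := ihb hzb h
      tauto

theorem mem_of_mem_loPath {k y : α} {t : RankedTree α} (ht : t.IsZipTree) (h : y ∈ t.loPath k) :
    y ∈ t.keys ∧ y < k := by
  induction t with
  | empty => simp [loPath] at h
  | node q key a b iha ihb =>
    obtain ⟨-, -, -, -, hza, hzb⟩ := ht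
    simp only [loPath] at h
    simp only [keys, Set.mem_union, Set.mem_singleton_iff]
    split_ifs at h with h1
    · rcases List.mem_cons.1 h with rfl | h
      · tauto
      · have := ihb hzb h
        tauto
    · have := iha hza h
      tauto

theorem nodup_ancestors {k : α} {t : RankedTree α} (ht : t.IsZipTree) : (t.ancestors k).Nodup := by
  induction t with
  | empty => simp [ancestors]
  | node q key a b iha ihb =>
    obtain ⟨h1, h2, -, -, hza, hzb⟩ := ht
    simp only [ancestors]
    split_ifs
    · simp
    · exact List.nodup_cons.2 ⟨fun h => (h1 _ (mem_keys_of_mem_ancestors h)).false, iha hza⟩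
    · exact List.nodup_cons.2 ⟨fun h => (h2 _ (mem_keys_of_mem_ancestors h)).false, ihb hzb⟩

theorem nodup_hiPath {k : α} {t : RankedTree α} (ht : t.IsZipTree) : (t.hiPath k).Nodup := by
  induction t with
  | empty => simp [hiPath]
  | node q key a b iha ihb =>
    obtain ⟨h1, -, -, -, hza, hzb⟩ := ht
    simp only [hiPath]
    split_ifs
    · exact List.nodup_cons.2 ⟨fun h => (h1 _ (mem_of_mem_hiPath hza h).1).false, iha hza⟩
    · exact ihb hzb

theorem nodup_loPath {k : α} {t : RankedTree α} (ht : t.IsZipTree) : (t.loPath k).Nodup := by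
  induction t with
  | empty => simp [loPath]
  | node q key a b iha ihb =>
    obtain ⟨-, h1, -, -, hza, hzb⟩ := ht
    simp only [loPath]
    split_ifs
    · exact List.nodup_cons.2 ⟨fun h => (h1 _ (mem_of_mem_loPath hzb h).1).false, ihb hzb⟩
    · exact iha hza

/-- The path to `x` turns left at `y`, so the keys of `t` in `[x, y)` all lie in the left subtree of
`y`, where ranks are strictly smaller. Steps above `y` keep `x` and `y` on the same side and discard
no key between them. -/
theorem record_of_mem_ancestors_of_lt {x y : α} {t : RankedTree α} (ht : t.IsZipTree)
    (h : y ∈ t.ancestors x) (hxy : x < y) :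
    ∃ q, ∀ z r, (z, r) ∈ t.nodes → (z = y → r = q) ∧ (z ∈ Set.Ico x y → r ∈ Set.Iio q) := by
  induction t with
  | empty => simp [ancestors] at h
  | node q key a b iha ihb =>
    obtain ⟨h1, h2, h3, h4, hza, hzb⟩ := ht
    simp only [nodes, Set.mem_union, Set.mem_singleton_iff, Prod.mk.injEq, Set.mem_Ico,
      Set.mem_Iio] at iha ihb ⊢
    simp only [ancestors] at h
    split_ifs at h with h5 h6
    · simp at h
    · rcases List.mem_cons.1 h with rfl | h
      · refine ⟨q, fun z r hz => ?_⟩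
        rcases hz with ⟨rfl, rfl⟩ | hz | hz
        · exact ⟨fun _ => rfl, fun h => (h.2.false).elim⟩
        · have := h1 z (mem_keys_of_mem_nodes hz)
          have := hza.le_rk_of_mem_nodes hz
          exact ⟨fun h => by order, fun _ => by omega⟩
        · have := h2 z (mem_keys_of_mem_nodes hz)
          exact ⟨fun h => by order, fun h => by order⟩
      · obtain ⟨q', hq'⟩ := iha hza h
        have := h1 y (mem_keys_of_mem_ancestors h)
        refine ⟨q', fun z r hz => ?_⟩
        rcases hz with ⟨rfl, rfl⟩ | hz | hz
        · exact ⟨fun h => by order, fun h => by order⟩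
        · exact hq' z r hz
        · have := h2 z (mem_keys_of_mem_nodes hz)
          exact ⟨fun h => by order, fun h => by order⟩
    · rcases List.mem_cons.1 h with rfl | h
      · exact absurd hxy h6
      · obtain ⟨q', hq'⟩ := ihb hzb h
        have := h2 y (mem_keys_of_mem_ancestors h)
        refine ⟨q', fun z r hz => ?_⟩
        rcases hz with ⟨rfl, rfl⟩ | hz | hz
        · exact ⟨fun h => by order, fun h => by order⟩
        · have := h1 z (mem_keys_of_mem_nodes hz)
          exact ⟨fun h => by order, fun h => by order⟩
        · exact hq' z r hz

theorem record_of_mem_ancestors_of_gt {x y : α} {t : RankedTree α} (ht : t.IsZipTree)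
    (h : y ∈ t.ancestors x) (hxy : y < x) :
    ∃ q, ∀ z r, (z, r) ∈ t.nodes → (z = y → r = q) ∧ (z ∈ Set.Ioc y x → r ∈ Set.Iic q) := by
  induction t with
  | empty => simp [ancestors] at h
  | node q key a b iha ihb =>
    obtain ⟨h1, h2, h3, h4, hza, hzb⟩ := ht
    simp only [nodes, Set.mem_union, Set.mem_singleton_iff, Prod.mk.injEq, Set.mem_Ioc,
      Set.mem_Iic] at iha ihb ⊢
    simp only [ancestors] at h
    split_ifs at h with h5 h6
    · simp at h
    · rcases List.mem_cons.1 h with rfl | h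
      · order
      · obtain ⟨q', hq'⟩ := iha hza h
        have := h1 y (mem_keys_of_mem_ancestors h)
        refine ⟨q', fun z r hz => ?_⟩
        rcases hz with ⟨rfl, rfl⟩ | hz | hz
        · exact ⟨fun h => by order, fun h => by order⟩
        · exact hq' z r hz
        · have := h2 z (mem_keys_of_mem_nodes hz)
          exact ⟨fun h => by order, fun h => by order⟩
    · rcases List.mem_cons.1 h with rfl | h
      · refine ⟨q, fun z r hz => ?_⟩
        rcases hz with ⟨rfl, rfl⟩ | hz | hz
        · exact ⟨fun _ => rfl, fun h => (h.1.false).elim⟩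
        · have := h1 z (mem_keys_of_mem_nodes hz)
          exact ⟨fun h => by order, fun h => by order⟩
        · have := h2 z (mem_keys_of_mem_nodes hz)
          have := hzb.le_rk_of_mem_nodes hz
          exact ⟨fun h => by order, fun _ => by omega⟩
      · obtain ⟨q', hq'⟩ := ihb hzb h
        have := h2 y (mem_keys_of_mem_ancestors h)
        refine ⟨q', fun z r hz => ?_⟩
        rcases hz with ⟨rfl, rfl⟩ | hz | hz
        · exact ⟨fun h => by order, fun h => by order⟩
        · have := h1 z (mem_keys_of_mem_nodes hz)
          exact ⟨fun h => by order, fun h => by order⟩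
        · exact hq' z r hz

/-- As for ancestors, but with the interval open at `k`: beyond a node with key `k` the path follows
the left spine of its right subtree, and the rank of `k` itself is no constraint. -/
theorem record_of_mem_hiPath {k y : α} {t : RankedTree α} (ht : t.IsZipTree)
    (h : y ∈ t.hiPath k) :
    ∃ q, ∀ z r, (z, r) ∈ t.nodes → (z = y → r = q) ∧ (z ∈ Set.Ioo k y → r ∈ Set.Iio q) := by
  induction t with
  | empty => simp [hiPath] at h
  | node q key a b iha ihb =>
    obtain ⟨h1, h2, h3, h4, hza, hzb⟩ := ht
    simp only [nodes, Set.mem_union, Set.mem_singleton_iff, Prod.mk.injEq, Set.mem_Ioo,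
      Set.mem_Iio] at iha ihb ⊢
    simp only [hiPath] at h
    split_ifs at h with h6
    · rcases List.mem_cons.1 h with rfl | h
      · refine ⟨q, fun z r hz => ?_⟩
        rcases hz with ⟨rfl, rfl⟩ | hz | hz
        · exact ⟨fun _ => rfl, fun h => (h.2.false).elim⟩
        · have := h1 z (mem_keys_of_mem_nodes hz)
          have := hza.le_rk_of_mem_nodes hz
          exact ⟨fun h => by order, fun _ => by omega⟩
        · have := h2 z (mem_keys_of_mem_nodes hz)
          exact ⟨fun h => by order, fun h => by order⟩
      · obtain ⟨q', hq'⟩ := iha hza h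
        have := h1 y (mem_of_mem_hiPath hza h).1
        refine ⟨q', fun z r hz => ?_⟩
        rcases hz with ⟨rfl, rfl⟩ | hz | hz
        · exact ⟨fun h => by order, fun h => by order⟩
        · exact hq' z r hz
        · have := h2 z (mem_keys_of_mem_nodes hz)
          exact ⟨fun h => by order, fun h => by order⟩
    · obtain ⟨q', hq'⟩ := ihb hzb h
      have := h2 y (mem_of_mem_hiPath hzb h).1
      refine ⟨q', fun z r hz => ?_⟩
      rcases hz with ⟨rfl, rfl⟩ | hz | hz
      · exact ⟨fun h => by order, fun h => by order⟩
      · have := h1 z (mem_keys_of_mem_nodes hz)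
        exact ⟨fun h => by order, fun h => by order⟩
      · exact hq' z r hz

theorem record_of_mem_loPath {k y : α} {t : RankedTree α} (ht : t.IsZipTree)
    (h : y ∈ t.loPath k) :
    ∃ q, ∀ z r, (z, r) ∈ t.nodes → (z = y → r = q) ∧ (z ∈ Set.Ioo y k → r ∈ Set.Iic q) := by
  induction t with
  | empty => simp [loPath] at h
  | node q key a b iha ihb =>
    obtain ⟨h1, h2, h3, h4, hza, hzb⟩ := ht
    simp only [nodes, Set.mem_union, Set.mem_singleton_iff, Prod.mk.injEq, Set.mem_Ioo,
      Set.mem_Iic] at iha ihb ⊢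
    simp only [loPath] at h
    split_ifs at h with h6
    · rcases List.mem_cons.1 h with rfl | h
      · refine ⟨q, fun z r hz => ?_⟩
        rcases hz with ⟨rfl, rfl⟩ | hz | hz
        · exact ⟨fun _ => rfl, fun h => (h.1.false).elim⟩
        · have := h1 z (mem_keys_of_mem_nodes hz)
          exact ⟨fun h => by order, fun h => by order⟩
        · have := h2 z (mem_keys_of_mem_nodes hz)
          have := hzb.le_rk_of_mem_nodes hz
          exact ⟨fun h => by order, fun _ => by omega⟩
      · obtain ⟨q', hq'⟩ := ihb hzb h
        have := h2 y (mem_of_mem_loPath hzb h).1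
        refine ⟨q', fun z r hz => ?_⟩
        rcases hz with ⟨rfl, rfl⟩ | hz | hz
        · exact ⟨fun h => by order, fun h => by order⟩
        · have := h1 z (mem_keys_of_mem_nodes hz)
          exact ⟨fun h => by order, fun h => by order⟩
        · exact hq' z r hz
    · obtain ⟨q', hq'⟩ := iha hza h
      have := h1 y (mem_of_mem_loPath hza h).1
      refine ⟨q', fun z r hz => ?_⟩
      rcases hz with ⟨rfl, rfl⟩ | hz | hz
      · exact ⟨fun h => by order, fun h => by order⟩
      · exact hq' z r hz
      · have := h2 z (mem_keys_of_mem_nodes hz)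
        exact ⟨fun h => by order, fun h => by order⟩

/-! ### Depth and costs in terms of search paths -/

theorem depth_eq_numHigh_add_numLow (x : α) (t : RankedTree α) :
    t.depth x = t.numHigh x + t.numLow x := by
  simp only [depth, numHigh, numLow]
  induction t with
  | empty => simp [ancestors]
  | node q key a b iha ihb =>
    simp only [ancestors]
    split_ifs with h1 h2
    · simp
    · simp [h2, h2.not_gt, iha]
      omega
    · have h3 : key < x := by order
      simp [h3, h2, ihb]
      omega

theorem insert_cost_le (r : ℕ) (k : α) (t : RankedTree α) :
    (t.insert r k).2 ≤ (t.hiPath k).length + (t.loPath k).length := by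
  induction t with
  | empty => simp [insert]
  | node q key a b iha ihb =>
    simp only [insert, hiPath, loPath]
    split_ifs with h1 h2 h3 h4 <;> try (exfalso; order)
    all_goals simp
    all_goals omega

/-- Each call of zip descends either the left spine of `t` or the right spine of `s`; since `k`
separates the keys, these spines are the high and the low path of `k`. -/
theorem zip_cost_le (k : α) (s t : RankedTree α) (hs : ∀ y ∈ s.keys, y < k)
    (ht : ∀ y ∈ t.keys, k < y) :
    (zip s t).2 ≤ (t.hiPath k).length + (s.loPath k).length := by
  induction s, t using zip.induct with
  | case1 t => simp [zip]
  | case2 => simp [zip]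
  | case3 r₁ k₁ a₁ b₁ r₂ k₂ a₂ b₂ h ih =>
    simp only [keys, Set.mem_union, Set.mem_singleton_iff] at ht
    have := ih hs fun y hy => ht y (.inr (.inl hy))
    rw [zip, if_pos h, hiPath, if_pos (ht k₂ (.inl rfl))]
    simp only [List.length_cons]
    omega
  | case4 r₁ k₁ a₁ b₁ r₂ k₂ a₂ b₂ h ih =>
    simp only [keys, Set.mem_union, Set.mem_singleton_iff] at hs
    have := ih (fun y hy => hs y (.inr (.inr hy))) ht
    rw [zip, if_neg h, loPath, if_pos (hs k₁ (.inl rfl))]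
    simp only [List.length_cons]
    omega

theorem delete_cost_le (k : α) (t : RankedTree α) (ht : t.IsZipTree) :
    (t.delete k).2 ≤ (t.hiPath k).length + (t.loPath k).length := by
  induction t with
  | empty => simp [delete]
  | node q key a b iha ihb =>
    obtain ⟨h1, h2, -, -, hza, hzb⟩ := ht
    have iha := iha hza
    have ihb := ihb hzb
    simp only [delete, hiPath, loPath]
    split_ifs with h3 h4 <;> try (exfalso; order)
    · simp only [List.length_cons]; omega
    · simp only [List.length_cons]; omega
    · have : k = key := by order
      subst this
      exact zip_cost_le k a b h1 h2

end RankedTree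

/-! ### Record probabilities for geometric ranks -/

theorem geo_apply (q : ℕ) : geo q = ENNReal.ofReal ((1 / 2) ^ (q + 1)) := by
  change (1 / 2 ^ (q + 1) : ℝ≥0∞) = _
  rw [ENNReal.ofReal_pow (by norm_num), ENNReal.ofReal_div_of_pos (by norm_num)]
  simp [ENNReal.inv_pow]

theorem geo_succ (q : ℕ) : geo (q + 1) = 2⁻¹ * geo q := by
  rw [geo_apply, geo_apply, pow_succ', ENNReal.ofReal_mul (by norm_num)]
  congr 1
  rw [ENNReal.ofReal_div_of_pos (by norm_num)]
  simp

theorem expectENN_geo_Iic (q : ℕ) :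
    expectENN geo ((Set.Iic q).indicator 1) = ENNReal.ofReal (1 - (1 / 2) ^ (q + 1)) := by
  have h : expectENN geo ((Set.Iic q).indicator 1) = ∑ r ∈ Finset.range (q + 1), geo r := by
    rw [expectENN, tsum_eq_sum (s := Finset.range (q + 1))]
    · refine Finset.sum_congr rfl fun r hr => ?_
      have : r ≤ q := by simpa [Nat.lt_succ_iff] using hr
      simp [this]
    · intro r hr
      have : ¬ r ≤ q := by simpa [Nat.lt_succ_iff] using hr
      simp [this]
  rw [h]
  simp only [geo_apply]
  rw [← ENNReal.ofReal_sum_of_nonneg fun _ _ => by positivity]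
  congr 1
  simp only [pow_succ', ← Finset.mul_sum]
  rw [geom_sum_eq (by norm_num), pow_succ']
  ring

theorem expectENN_geo_Iio_zero : expectENN geo ((Set.Iio 0).indicator 1) = 0 := by
  simp [expectENN]

theorem expectENN_geo_Iio_succ (q : ℕ) :
    expectENN geo ((Set.Iio (q + 1)).indicator 1) = expectENN geo ((Set.Iic q).indicator 1) := by
  congr 2
  ext r
  simp

/-- The probability that a geometric rank is greater than `j` independent ones. -/
noncomputable def strictRecord (j : ℕ) : ℝ≥0∞ :=
  ∑' q, geo q * expectENN geo ((Set.Iio q).indicator 1) ^ j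

/-- The probability that a geometric rank is at least as large as `j` independent ones. -/
noncomputable def weakRecord (j : ℕ) : ℝ≥0∞ :=
  ∑' q, geo q * expectENN geo ((Set.Iic q).indicator 1) ^ j

theorem strictRecord_zero : strictRecord 0 = 1 := by
  simp [strictRecord]

theorem weakRecord_zero : weakRecord 0 = 1 := by
  simp [weakRecord]

/-- Rank `0` cannot strictly beat a competitor. Otherwise lower the record rank by one: `r < q + 1`
becomes `r ≤ q`, and the mass of the record rank doubles. -/
theorem strictRecord_succ (j : ℕ) : strictRecord (j + 1) = 2⁻¹ * weakRecord (j + 1) := by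
  rw [strictRecord, tsum_eq_zero_add' ENNReal.summable, expectENN_geo_Iio_zero]
  simp only [expectENN_geo_Iio_succ, geo_succ, mul_assoc, ENNReal.tsum_mul_left, weakRecord]
  simp

theorem sum_geo_mul_pow_le_one (m q : ℕ) :
    ∑ j ∈ Finset.range m, geo q * expectENN geo ((Set.Iic q).indicator 1) ^ j ≤ 1 := by
  have hp : ((1 : ℝ) / 2) ^ (q + 1) ≤ 1 := pow_le_one₀ (by norm_num) (by norm_num)
  have h0 : (0 : ℝ) ≤ 1 - (1 / 2) ^ (q + 1) := by linarith
  rw [expectENN_geo_Iic, geo_apply]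
  simp only [← ENNReal.ofReal_pow h0]
  rw [← Finset.mul_sum, ← ENNReal.ofReal_sum_of_nonneg fun _ _ => pow_nonneg h0 _,
    ← ENNReal.ofReal_mul (by positivity), ← ENNReal.ofReal_one]
  refine ENNReal.ofReal_le_ofReal ?_
  have := mul_neg_geom_sum (1 - ((1 : ℝ) / 2) ^ (q + 1)) m
  rw [sub_sub_cancel] at this
  rw [this]
  have := pow_nonneg h0 m
  linarith

theorem sum_geo_mul_pow_le_mul (m q : ℕ) :
    ∑ j ∈ Finset.range m, geo q * expectENN geo ((Set.Iic q).indicator 1) ^ j ≤ m * geo q := by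
  have h1 : expectENN geo ((Set.Iic q).indicator 1) ≤ 1 := by
    rw [expectENN_geo_Iic, ← ENNReal.ofReal_one]
    refine ENNReal.ofReal_le_ofReal ?_
    have : (0 : ℝ) ≤ (1 / 2) ^ (q + 1) := by positivity
    linarith
  refine (Finset.sum_le_card_nsmul _ _ (geo q) fun j _ => ?_).trans (by simp)
  exact mul_le_of_le_one_right' (pow_le_one₀ (by simp) h1)

theorem log_add_div_le_logb (m : ℕ) (hm : m ≠ 0) :
    (Nat.log 2 m : ℝ) + m / 2 ^ Nat.log 2 m ≤ Real.logb 2 m + 1 := by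
  set L := Nat.log 2 m
  have hm' : (0 : ℝ) < m := by positivity
  have hL : (2 : ℝ) ^ L ≤ m := by exact_mod_cast Nat.pow_log_le_self 2 hm
  have hL' : (m : ℝ) ≤ 2 ^ (L + 1) := by
    exact_mod_cast (Nat.lt_pow_succ_log_self (by norm_num) m).le
  have hp : (0 : ℝ) < 2 ^ L := by positivity
  set u : ℝ := m / 2 ^ L with hu
  have hu1 : 1 ≤ u := by rwa [hu, le_div_iff₀ hp, one_mul]
  have hu2 : u ≤ 2 := by
    rw [hu, div_le_iff₀ hp]
    rw [pow_succ'] at hL'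
    exact hL'
  have h1 : Real.logb 2 u ≤ 1 := by
    rw [Real.logb_le_iff_le_rpow (by norm_num) (by linarith)]
    simpa using hu2
  -- Bernoulli's inequality with exponent `log₂ u` in `[0, 1]`: `u = 2 ^ log₂ u ≤ 1 + log₂ u`.
  have h2 := rpow_one_add_le_one_add_mul_self (s := 1) (by norm_num)
    (Real.logb_nonneg (by norm_num) hu1) h1
  rw [one_add_one_eq_two, Real.rpow_logb (by norm_num) (by norm_num) (by linarith)] at h2
  have h3 : Real.logb 2 u = Real.logb 2 m - L := by
    rw [hu, Real.logb_div hm'.ne' hp.ne', Real.logb_pow]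
    simp
  linarith

theorem sum_weakRecord_le (m : ℕ) :
    ∑ j ∈ Finset.range m, weakRecord j ≤ ENNReal.ofReal (Real.logb 2 m + 1) := by
  rcases eq_or_ne m 0 with rfl | hm
  · simp
  refine le_trans ?_ (ENNReal.ofReal_le_ofReal (log_add_div_le_logb m hm))
  set L := Nat.log 2 m
  simp only [weakRecord]
  rw [← Summable.tsum_finsetSum fun _ _ => ENNReal.summable,
    -- Ranks below `L` contribute at most `1` each; the tail is at most `m` times the mass `1 / 2 ^
    -- L` of the ranks from `L` on.
    ← ENNReal.summable.sum_add_tsum_nat_add' (k := L),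
    ENNReal.ofReal_add (by positivity) (by positivity)]
  refine add_le_add ?_ ?_
  · refine (Finset.sum_le_card_nsmul _ _ 1 fun q _ => sum_geo_mul_pow_le_one m q).trans ?_
    simp
  · refine (ENNReal.tsum_le_tsum fun q => sum_geo_mul_pow_le_mul m (q + L)).trans ?_
    have : ∀ q, (m : ℝ≥0∞) * geo (q + L) = ENNReal.ofReal (m / 2 ^ L) * geo q := by
      intro q
      rw [geo_apply, geo_apply, ← ENNReal.ofReal_natCast, ← ENNReal.ofReal_mul (by positivity),
        ← ENNReal.ofReal_mul (by positivity), add_right_comm, pow_add _ (q + 1), one_div_pow 2 L]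
      congr 1
      ring
    simp only [this, ENNReal.tsum_mul_left, PMF.tsum_coe, mul_one, le_refl]

theorem sum_weakRecord_succ_le (m : ℕ) :
    ∑ j ∈ Finset.range m, weakRecord (j + 1) ≤ ENNReal.ofReal (Real.logb 2 (m + 1 : ℕ) + 1) := by
  refine le_trans ?_ (sum_weakRecord_le (m + 1))
  rw [Finset.sum_range_succ']
  exact le_self_add

theorem sum_strictRecord_succ_le (m : ℕ) :
    ∑ j ∈ Finset.range m, strictRecord (j + 1) ≤
      ENNReal.ofReal (1 / 2 * (Real.logb 2 (m + 1 : ℕ) + 1)) := by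
  simp only [strictRecord_succ, ← Finset.mul_sum]
  rw [ENNReal.ofReal_mul (by norm_num), one_div, ENNReal.ofReal_inv_of_pos (by norm_num)]
  have := sum_weakRecord_succ_le m
  simp only [ENNReal.ofReal_ofNat]
  gcongr

theorem sum_strictRecord_le (m : ℕ) :
    ∑ j ∈ Finset.range m, strictRecord j ≤ ENNReal.ofReal (1 + 1 / 2 * Real.logb 2 m) := by
  rcases m with _ | m
  · simp
  have h0 : 0 ≤ Real.logb 2 (m + 1 : ℕ) :=
    Real.logb_nonneg (by norm_num) (by exact_mod_cast Nat.le_add_left 1 m)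
  have h := sum_weakRecord_le (m + 1)
  rw [Finset.sum_range_succ', weakRecord_zero, ENNReal.ofReal_add h0 (by norm_num),
    ENNReal.ofReal_one] at h
  -- The term `j = 0` equals `1` for strict and weak records alike, so it is taken off before
  -- halving.
  have h' := ENNReal.le_of_add_le_add_right (by simp) h
  rw [Finset.sum_range_succ', strictRecord_zero]
  simp only [strictRecord_succ, ← Finset.mul_sum]
  rw [ENNReal.ofReal_add (by norm_num) (by positivity), ENNReal.ofReal_mul (by norm_num), one_div,
    ENNReal.ofReal_inv_of_pos (by norm_num), add_comm]
  simp only [ENNReal.ofReal_ofNat, ENNReal.ofReal_one]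
  gcongr

/-! ### Numbers of competitors and the final estimates -/

/-- The number of smaller elements takes each value below `s.card` once: a new maximum adds the next
value and changes no other. -/
theorem Finset.sum_card_filter_lt {α M : Type*} [LinearOrder α] [AddCommMonoid M] (s : Finset α)
    (g : ℕ → M) : ∑ y ∈ s, g (s.filter (· < y)).card = ∑ j ∈ Finset.range s.card, g j := by
  induction s using Finset.induction_on_max with
  | empty => simp
  | insert a s ha ih =>
    have has : a ∉ s := fun h => (ha a h).false
    rw [Finset.sum_insert has, Finset.card_insert_of_notMem has, Finset.sum_range_succ, ← ih,
      add_comm]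
    congr 1
    · refine Finset.sum_congr rfl fun y hy => ?_
      rw [Finset.filter_insert, if_neg (ha y hy).not_gt]
    · rw [Finset.filter_insert, if_neg (lt_irrefl a), Finset.filter_true_of_mem ha]

theorem Finset.sum_card_filter_gt {α M : Type*} [LinearOrder α] [AddCommMonoid M] (s : Finset α)
    (g : ℕ → M) : ∑ y ∈ s, g (s.filter (y < ·)).card = ∑ j ∈ Finset.range s.card, g j :=
  Finset.sum_card_filter_lt (α := αᵒᵈ) s g

namespace RankedTree

variable {α : Type*} [LinearOrder α]

theorem expect_length_hiPath_le (l : List α) (hl : l.Nodup) (k : α) :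
    expect (insertList l) (fun t => (t.hiPath k).length) ≤
      ∑ j ∈ Finset.range (l.toFinset.filter (k < ·)).card, strictRecord j := by
  classical
  refine (expect_length_le l hl (hiPath k) (l.toFinset.filter (k < ·)) (Finset.filter_subset _ _)
    (fun y => Set.Ioo k y) Set.Iio (by simp) (fun t ht => nodup_hiPath (insertList_spec l t ht).1)
    ?_ fun t ht y hy => record_of_mem_hiPath (insertList_spec l t ht).1 hy).trans
    (le_of_eq ?_)
  · intro t ht y hy
    have h := mem_of_mem_hiPath (insertList_spec l t ht).1 hy
    rw [(insertList_spec l t ht).2] at h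
    simpa using h
  · rw [← Finset.sum_card_filter_lt]
    refine Finset.sum_congr rfl fun y _ => ?_
    rw [Finset.filter_filter, strictRecord]
    congr! 5
    simp

theorem expect_length_loPath_le (l : List α) (hl : l.Nodup) (k : α) :
    expect (insertList l) (fun t => (t.loPath k).length) ≤
      ∑ j ∈ Finset.range (l.toFinset.filter (· < k)).card, weakRecord j := by
  classical
  refine (expect_length_le l hl (loPath k) (l.toFinset.filter (· < k)) (Finset.filter_subset _ _)
    (fun y => Set.Ioo y k) Set.Iic (by simp) (fun t ht => nodup_loPath (insertList_spec l t ht).1)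
    ?_ fun t ht y hy => record_of_mem_loPath (insertList_spec l t ht).1 hy).trans
    (le_of_eq ?_)
  · intro t ht y hy
    have h := mem_of_mem_loPath (insertList_spec l t ht).1 hy
    rw [(insertList_spec l t ht).2] at h
    simpa using h
  · rw [← Finset.sum_card_filter_gt]
    refine Finset.sum_congr rfl fun y _ => ?_
    rw [Finset.filter_filter, weakRecord]
    congr! 5
    simp [and_comm]

theorem expect_numHigh_le (l : List α) (hl : l.Nodup) (x : α) (hx : x ∈ l) :
    expect (insertList l) (fun t => t.numHigh x) ≤
      ∑ j ∈ Finset.range (l.toFinset.filter (x < ·)).card, strictRecord (j + 1) := by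
  classical
  refine (expect_length_le l hl (fun t => (t.ancestors x).filter (fun y => x < y))
    (l.toFinset.filter (x < ·)) (Finset.filter_subset _ _) (fun y => Set.Ico x y) Set.Iio (by simp)
    (fun t ht => (nodup_ancestors (insertList_spec l t ht).1).filter _) ?_ ?_).trans (le_of_eq ?_)
  · intro t ht y hy
    obtain ⟨h, h'⟩ := List.mem_filter.1 hy
    have h := mem_keys_of_mem_ancestors h
    rw [(insertList_spec l t ht).2] at h
    exact Finset.mem_filter.2 ⟨List.mem_toFinset.2 h, of_decide_eq_true h'⟩
  · intro t ht y hy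
    obtain ⟨h, h'⟩ := List.mem_filter.1 hy
    exact record_of_mem_ancestors_of_lt (insertList_spec l t ht).1 h (by simpa using h')
  · rw [← Finset.sum_card_filter_lt _ fun j => strictRecord (j + 1)]
    refine Finset.sum_congr rfl fun y hy => ?_
    have hxy : x < y := (Finset.mem_filter.1 hy).2
    -- Besides the keys strictly between, `[x, y)` contains the key `x` itself, hence `j + 1`
    -- competitors.
    rw [Finset.filter_filter, strictRecord, ← Finset.card_insert_of_notMem (a := x) (by simp)]
    congr! 5
    ext z
    simp only [Finset.mem_filter, Finset.mem_insert, List.mem_toFinset, Set.mem_Ico]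
    constructor
    · rintro ⟨h1, h2, h3⟩
      rcases h2.eq_or_lt with h2 | h2
      · exact .inl h2.symm
      · exact .inr ⟨h1, h2, h3⟩
    · rintro (rfl | ⟨h1, h2, h3⟩)
      · exact ⟨hx, le_rfl, hxy⟩
      · exact ⟨h1, h2.le, h3⟩

theorem expect_numLow_le (l : List α) (hl : l.Nodup) (x : α) (hx : x ∈ l) :
    expect (insertList l) (fun t => t.numLow x) ≤
      ∑ j ∈ Finset.range (l.toFinset.filter (· < x)).card, weakRecord (j + 1) := by
  classical
  refine (expect_length_le l hl (fun t => (t.ancestors x).filter (fun y => y < x))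
    (l.toFinset.filter (· < x)) (Finset.filter_subset _ _) (fun y => Set.Ioc y x) Set.Iic (by simp)
    (fun t ht => (nodup_ancestors (insertList_spec l t ht).1).filter _) ?_ ?_).trans (le_of_eq ?_)
  · intro t ht y hy
    obtain ⟨h, h'⟩ := List.mem_filter.1 hy
    have h := mem_keys_of_mem_ancestors h
    rw [(insertList_spec l t ht).2] at h
    exact Finset.mem_filter.2 ⟨List.mem_toFinset.2 h, of_decide_eq_true h'⟩
  · intro t ht y hy
    obtain ⟨h, h'⟩ := List.mem_filter.1 hy
    exact record_of_mem_ancestors_of_gt (insertList_spec l t ht).1 h (by simpa using h')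
  · rw [← Finset.sum_card_filter_gt _ fun j => weakRecord (j + 1)]
    refine Finset.sum_congr rfl fun y hy => ?_
    have hxy : y < x := (Finset.mem_filter.1 hy).2
    rw [Finset.filter_filter, weakRecord, ← Finset.card_insert_of_notMem (a := x) (by simp)]
    congr! 5
    ext z
    simp only [Finset.mem_filter, Finset.mem_insert, List.mem_toFinset, Set.mem_Ioc]
    constructor
    · rintro ⟨h1, h2, h3⟩
      rcases h3.eq_or_lt with h3 | h3
      · exact .inl h3
      · exact .inr ⟨h1, h3, h2⟩
    · rintro (rfl | ⟨h1, h2, h3⟩)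
      · exact ⟨hx, hxy, le_rfl⟩
      · exact ⟨h1, h3, h2.le⟩

theorem card_filter_gt_add_card_filter_lt_le (l : List α) (k : α) :
    (l.toFinset.filter (k < ·)).card + (l.toFinset.filter (· < k)).card ≤ l.length := by
  rw [← Finset.card_union_of_disjoint]
  · exact (Finset.card_le_card (Finset.union_subset (Finset.filter_subset _ _)
      (Finset.filter_subset _ _))).trans l.toFinset_card_le
  · exact Finset.disjoint_filter.2 fun _ _ h => h.not_gt

theorem card_filter_succ_le (l : List α) (x : α) (hx : x ∈ l) (p : α → Prop) [DecidablePred p]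
    (hp : ¬ p x) : (l.toFinset.filter p).card + 1 ≤ l.length :=
  (Finset.card_lt_card (Finset.filter_ssubset.2 ⟨x, by simpa using hx, hp⟩)).trans_le
    l.toFinset_card_le

theorem logb_natCast_le {m n : ℕ} (hm : m ≠ 0) (h : m ≤ n) : Real.logb 2 m ≤ Real.logb 2 n :=
  Real.logb_le_logb_of_le (by norm_num) (by positivity) (by exact_mod_cast h)

theorem sum_strictRecord_add_sum_weakRecord_le (a b n : ℕ) (h : a + b ≤ n) (hn : n ≠ 0) :
    ∑ j ∈ Finset.range a, strictRecord j + ∑ j ∈ Finset.range b, weakRecord j ≤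
      ENNReal.ofReal (3 / 2 * Real.logb 2 n + 3 / 2) := by
  have h0 : ∀ m : ℕ, 0 ≤ Real.logb 2 m := by
    intro m
    rcases Nat.eq_zero_or_pos m with rfl | hm
    · simp
    · exact Real.logb_nonneg (by norm_num) (by exact_mod_cast hm)
  have hn0 := h0 n
  -- An empty side contributes nothing, but its general bound would be `1` because `Real.logb 2 0 =
  -- 0`, which is too much when `n = 1`.
  rcases eq_or_ne a 0 with rfl | ha
  · rcases eq_or_ne b 0 with rfl | hb
    · simp
    · rw [Finset.range_zero, Finset.sum_empty, zero_add]
      refine (sum_weakRecord_le b).trans (ENNReal.ofReal_le_ofReal ?_)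
      have := logb_natCast_le hb (show b ≤ n by omega)
      linarith
  · rcases eq_or_ne b 0 with rfl | hb
    · rw [Finset.range_zero, Finset.sum_empty, add_zero]
      refine (sum_strictRecord_le a).trans (ENNReal.ofReal_le_ofReal ?_)
      have := logb_natCast_le ha (show a ≤ n by omega)
      linarith
    · refine (add_le_add (sum_strictRecord_le a) (sum_weakRecord_le b)).trans ?_
      rw [← ENNReal.ofReal_add (by linarith [h0 a]) (by linarith [h0 b])]
      refine ENNReal.ofReal_le_ofReal ?_
      have h1 := logb_natCast_le hb (show b ≤ n by omega)
      have ha' : (0 : ℝ) < a := by positivity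
      have hb' : (0 : ℝ) < b := by positivity
      have hn' : (0 : ℝ) < n := by positivity
      -- `4ab ≤ (a + b)² ≤ n²`. Half of the resulting inequality saves `1`, and the other half of
      -- `log₂ b` is at most half of `log₂ n`.
      have h2 : Real.logb 2 (2 ^ 2 * (a * b)) ≤ Real.logb 2 (n * n) := by
        refine Real.logb_le_logb_of_le (by norm_num) (by positivity) ?_
        have : (a : ℝ) + b ≤ n := by exact_mod_cast h
        nlinarith [sq_nonneg ((a : ℝ) - b)]
      rw [Real.logb_mul (by norm_num) (by positivity), Real.logb_mul ha'.ne' hb'.ne',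
        Real.logb_mul hn'.ne' hn'.ne', Real.logb_pow, Real.logb_self_eq_one (by norm_num)] at h2
      push_cast at h2
      linarith

theorem expect_le_of_le_searchPath (l : List α) (hl : l.Nodup) (hne : l ≠ []) (k : α)
    (cost : RankedTree α → ℕ)
    (h : ∀ t : RankedTree α, t.IsZipTree → cost t ≤ (t.hiPath k).length + (t.loPath k).length) :
    expect (insertList l) cost ≤ ENNReal.ofReal (3 / 2 * Real.logb 2 l.length + 3 / 2) := by
  refine le_trans ?_ (sum_strictRecord_add_sum_weakRecord_le _ _ l.length
    (card_filter_gt_add_card_filter_lt_le l k) (by simpa using hne))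
  refine le_trans ?_ (add_le_add (expect_length_hiPath_le l hl k) (expect_length_loPath_le l hl k))
  simp only [expect_eq_expectENN]
  rw [← expectENN_add]
  exact expectENN_mono fun t ht => by exact_mod_cast h t (insertList_spec l t ht).1

end RankedTree

open RankedTree in
theorem mainTheorem1 {α : Type*} [LinearOrder α] (l : List α) (hl : l.Nodup) (hne : l ≠ []) :
    (∀ x ∈ l,
      expect (insertList l) (fun t => t.depth x) ≤
          ENNReal.ofReal (3 / 2 * (Real.logb 2 l.length + 1)) ∧
        expect (insertList l) (fun t => t.numHigh x) ≤
          ENNReal.ofReal (1 / 2 * (Real.logb 2 l.length + 1)) ∧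
        expect (insertList l) (fun t => t.numLow x) ≤
          ENNReal.ofReal (Real.logb 2 l.length + 1)) ∧
      (∀ k : α,
        expect ((insertList l).bind (randomInsert k)) (fun p => p.2) ≤
          ENNReal.ofReal (3 / 2 * Real.logb 2 l.length + 3 / 2)) ∧
      ∀ k : α,
        expect ((insertList l).map (fun t => t.delete k)) (fun p => p.2) ≤
          ENNReal.ofReal (3 / 2 * Real.logb 2 l.length + 3 / 2) := by
  refine ⟨fun x hx => ?_, fun k => ?_, fun k => ?_⟩
  · have hhigh : expect (insertList l) (fun t => t.numHigh x) ≤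
        ENNReal.ofReal (1 / 2 * (Real.logb 2 l.length + 1)) := by
      refine (expect_numHigh_le l hl x hx).trans ((sum_strictRecord_succ_le _).trans
        (ENNReal.ofReal_le_ofReal ?_))
      have := logb_natCast_le (Nat.succ_ne_zero _)
        (card_filter_succ_le l x hx (x < ·) (lt_irrefl x))
      linarith
    have hlow : expect (insertList l) (fun t => t.numLow x) ≤
        ENNReal.ofReal (Real.logb 2 l.length + 1) := by
      refine (expect_numLow_le l hl x hx).trans ((sum_weakRecord_succ_le _).trans
        (ENNReal.ofReal_le_ofReal ?_))
      have := logb_natCast_le (Nat.succ_ne_zero _)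
        (card_filter_succ_le l x hx (· < x) (lt_irrefl x))
      linarith
    refine ⟨?_, hhigh, hlow⟩
    have h0 : 0 ≤ Real.logb 2 l.length := Real.logb_nonneg (by norm_num)
      (by exact_mod_cast List.length_pos_iff.2 hne)
    rw [show 3 / 2 * (Real.logb 2 l.length + 1) = 1 / 2 * (Real.logb 2 l.length + 1) +
      (Real.logb 2 l.length + 1) by ring, ENNReal.ofReal_add (by linarith) (by linarith)]
    refine le_trans (le_of_eq ?_) (add_le_add hhigh hlow)
    simp only [expect_eq_expectENN, depth_eq_numHigh_add_numLow, Nat.cast_add, expectENN_add]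
  · rw [expect_eq_expectENN, expectENN_bind]
    simp only [randomInsert, expectENN_map]
    refine le_trans (expectENN_mono fun t _ => ?_) (expect_le_of_le_searchPath l hl hne k
      (fun t => (t.hiPath k).length + (t.loPath k).length) fun _ _ => le_rfl)
    -- The path bound does not depend on the rank of the new node.
    refine (expectENN_mono fun r _ => ?_).trans (expectENN_const geo _).le
    exact_mod_cast insert_cost_le r k t
  · rw [expect_eq_expectENN, expectENN_map]
    exact expect_le_of_le_searchPath l hl hne k (fun t => (t.delete k).2) (delete_cost_le k)
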